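/- For a prime $p \equiv 1 \pmod 4$ let $h$ be the class number of the real quadratic field $\mathbb{Q}(\sqrt p)$, let $\varepsilon > 1$ be its fundamental unit (the unit of the ring of integers with $\varepsilon>1$ such that every unit is $\pm\varepsilon^n$ for some $n \in \mathbb{Z}$), and put $$\beta = \beta(p) = \frac{\log p + 2h\log\varepsilon}{(p-1)\log 2}.$$ Let $\mathcal{P}_{2,1}$ be the set of primes $p \equiv 1 \pmod 4$ for which $2$ has multiplicative order exactly $(p-1)/2$ modulo $p$. Then only finitely many $p \in \mathcal{P}_{2,1}$ satisfy $\beta(p) > 1/2$; in fact, $p = 17$ is the only such prime: $\{p \in \mathcal{P}_{2,1} : \beta(p) > 1/2\} = \{17\}$. -/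

import Mathlib

open scoped NumberField IntermediateField

namespace ThueMorse

/-- The quadratic field `ℚ(√d)`, as a subfield of `ℝ`. -/
noncomputable abbrev QSqrt (d : ℕ) : IntermediateField ℚ ℝ := ℚ⟮√(d : ℝ)⟯

theorem isIntegral_sqrt (d : ℕ) : IsIntegral ℚ √(d : ℝ) := by
  refine IsIntegral.of_pow (n := 2) two_pos ?_
  rw [Real.sq_sqrt d.cast_nonneg]
  simpa using (isIntegral_algebraMap (R := ℚ) (A := ℝ) (x := (d : ℚ)))

noncomputable instance (d : ℕ) : NumberField (QSqrt d) where
  to_charZero := inferInstance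
  to_finiteDimensional := IntermediateField.adjoin.finiteDimensional (isIntegral_sqrt d)

/-- The real number underlying a unit of the ring of integers of `ℚ(√d) ⊆ ℝ`. -/
noncomputable def unitVal (d : ℕ) (u : (𝓞 (QSqrt d))ˣ) : ℝ :=
  (((u : 𝓞 (QSqrt d)) : QSqrt d) : ℝ)

/-- `u` is the fundamental unit `> 1` of `ℚ(√d)`: every unit of the ring of integers is, up to
sign, an integral power of `u`. -/
def IsFundamentalUnit (d : ℕ) (u : (𝓞 (QSqrt d))ˣ) : Prop :=
  1 < unitVal d u ∧ ∀ v : (𝓞 (QSqrt d))ˣ, ∃ n : ℤ, v = u ^ n ∨ v = -u ^ n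

/-- The real number `ε > 1` given by the fundamental unit of `ℚ(√d)`. It is well defined for `d`
prime by `exists_isFundamentalUnit` and `IsFundamentalUnit.unique` below. -/
noncomputable def fundamentalUnit (d : ℕ) : ℝ :=
  unitVal d (Classical.epsilon (IsFundamentalUnit d))

theorem finrank_QSqrt {p : ℕ} (hp : p.Prime) : Module.finrank ℚ (QSqrt p) = 2 := by
  rw [IntermediateField.adjoin.finrank (isIntegral_sqrt p)]
  apply le_antisymm
  · have hm : (Polynomial.X ^ 2 - Polynomial.C (p : ℚ)).Monic :=
      Polynomial.monic_X_pow_sub_C _ two_ne_zero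
    have := minpoly.min ℚ √(p : ℝ) hm (by simp)
    rw [Polynomial.degree_X_pow_sub_C two_pos] at this
    exact Polynomial.natDegree_le_of_degree_le this
  · rw [minpoly.two_le_natDegree_iff (isIntegral_sqrt p)]
    rintro ⟨q, hq⟩
    exact hp.irrational_sqrt ⟨q, by simpa using hq⟩

theorem rank_QSqrt {p : ℕ} (hp : p.Prime) : NumberField.Units.rank (QSqrt p) = 1 := by
  classical
  have h := NumberField.InfinitePlace.card_add_two_mul_card_eq_rank (QSqrt p)
  rw [finrank_QSqrt hp] at h
  have h2 := NumberField.InfinitePlace.card_eq_nrRealPlaces_add_nrComplexPlaces (QSqrt p)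
  let φ : QSqrt p →+* ℂ := Complex.ofRealHom.comp (algebraMap (QSqrt p) ℝ)
  have hφ : NumberField.ComplexEmbedding.IsReal φ := by
    ext x
    simp [φ]
  have hpos : 0 < NumberField.InfinitePlace.nrRealPlaces (QSqrt p) :=
    Fintype.card_pos_iff.2 ⟨⟨NumberField.InfinitePlace.mk φ, ⟨φ, hφ, rfl⟩⟩⟩
  unfold NumberField.Units.rank
  omega

/-- `unitVal` as a monoid homomorphism. -/
noncomputable def unitValHom (d : ℕ) : (𝓞 (QSqrt d))ˣ →* ℝˣ :=
  Units.map ((algebraMap (QSqrt d) ℝ).comp (algebraMap (𝓞 (QSqrt d)) (QSqrt d)) : _ →* ℝ)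

theorem unitValHom_val (d : ℕ) (u : (𝓞 (QSqrt d))ˣ) :
    ((unitValHom d u : ℝˣ) : ℝ) = unitVal d u := rfl

theorem unitVal_injective (d : ℕ) : Function.Injective (unitVal d) := by
  intro u v h
  exact Units.ext (NumberField.RingOfIntegers.coe_injective (Subtype.ext h))

theorem unitVal_zpow (d : ℕ) (u : (𝓞 (QSqrt d))ˣ) (n : ℤ) :
    unitVal d (u ^ n) = unitVal d u ^ n := by
  rw [← unitValHom_val, map_zpow, Units.val_zpow_eq_zpow_val, unitValHom_val]

theorem unitVal_neg (d : ℕ) (u : (𝓞 (QSqrt d))ˣ) : unitVal d (-u) = -unitVal d u := by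
  simp [unitVal]

theorem unitVal_ne_zero (d : ℕ) (u : (𝓞 (QSqrt d))ˣ) : unitVal d u ≠ 0 :=
  (unitValHom d u).ne_zero

theorem torsion_eq {d : ℕ} {u : (𝓞 (QSqrt d))ˣ}
    (h : u ∈ NumberField.Units.torsion (QSqrt d)) : u = 1 ∨ u = -1 := by
  obtain ⟨n, hn, h1⟩ := isOfFinOrder_iff_pow_eq_one.1 h
  have h2 : unitVal d u ^ n = 1 := by
    have := unitVal_zpow d u n
    rw [zpow_natCast, zpow_natCast, h1] at this
    simpa [unitVal] using this.symm
  have h3 : |unitVal d u| = 1 := by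
    have : |unitVal d u| ^ n = 1 := by rw [← abs_pow, h2, abs_one]
    exact (pow_eq_one_iff_of_nonneg (abs_nonneg _) hn.ne').1 this
  rcases abs_eq zero_le_one |>.1 h3 with h | h
  · exact Or.inl (unitVal_injective d (by rw [h]; simp [unitVal]))
  · exact Or.inr (unitVal_injective d (by rw [h]; simp [unitVal]))

theorem fundSystem_notMem_torsion (K : Type*) [Field K] [NumberField K]
    (i : Fin (NumberField.Units.rank K)) :
    NumberField.Units.fundSystem K i ∉ NumberField.Units.torsion K := by
  intro hs
  have h := (NumberField.Units.exist_unique_eq_mul_prod K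
    (NumberField.Units.fundSystem K i)).unique
    (y₁ := (⟨_, hs⟩, 0)) (y₂ := (1, Pi.single i 1)) (by simp) (by
      rw [Fintype.prod_eq_single i (fun j hj => by simp [Pi.single_eq_of_ne hj])]
      simp)
  simpa using congrFun (congrArg Prod.snd h) i

theorem exists_isFundamentalUnit {p : ℕ} (hp : p.Prime) : ∃ u, IsFundamentalUnit p u := by
  have hr := rank_QSqrt hp
  let i0 : Fin (NumberField.Units.rank (QSqrt p)) := ⟨0, by omega⟩
  have hsub : ∀ i, i = i0 := fun i => Fin.ext (by have := i.2; simp only [i0]; omega)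
  -- a unit generating the units up to sign
  set e := NumberField.Units.fundSystem (QSqrt p) i0 with he
  have hgen : ∀ v : (𝓞 (QSqrt p))ˣ, ∃ n : ℤ, v = e ^ n ∨ v = -e ^ n := by
    intro v
    obtain ⟨⟨ζ, f⟩, hv, -⟩ := NumberField.Units.exist_unique_eq_mul_prod (QSqrt p) v
    refine ⟨f i0, ?_⟩
    rw [Fintype.prod_eq_single i0 (fun i hi => absurd (hsub i) hi)] at hv
    rcases torsion_eq ζ.2 with h | h
    · left; simpa [h] using hv
    · right; simpa [h] using hv
  have hne : unitVal p e ≠ 0 := unitVal_ne_zero p e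
  have habs : |unitVal p e| ≠ 1 := by
    intro h
    have hs : e ∈ NumberField.Units.torsion (QSqrt p) := by
      refine isOfFinOrder_iff_pow_eq_one.2 ⟨2, two_pos, unitVal_injective p ?_⟩
      have := unitVal_zpow p e (2 : ℕ)
      rw [zpow_natCast, zpow_natCast] at this
      rw [this, ← sq_abs, h]
      simp [unitVal]
    exact fundSystem_notMem_torsion (QSqrt p) i0 hs
  -- replace the generator by whichever of `±e`, `±e⁻¹` exceeds `1`
  have key : ∃ w : (𝓞 (QSqrt p))ˣ, 1 < |unitVal p w| ∧
      ∀ v : (𝓞 (QSqrt p))ˣ, ∃ n : ℤ, v = w ^ n ∨ v = -w ^ n := by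
    rcases lt_or_gt_of_ne habs with h | h
    · refine ⟨e⁻¹, ?_, fun v => ?_⟩
      · have := unitVal_zpow p e (-1)
        rw [zpow_neg_one, zpow_neg_one] at this
        rw [this, abs_inv]
        exact (one_lt_inv₀ (abs_pos.2 hne)).2 h
      · obtain ⟨n, hn⟩ := hgen v
        exact ⟨-n, by simpa using hn⟩
    · exact ⟨e, h, hgen⟩
  obtain ⟨w, hw, hg⟩ := key
  rcases lt_or_ge 0 (unitVal p w) with h | h
  · exact ⟨w, by rwa [abs_of_pos h] at hw, hg⟩
  · refine ⟨-w, by rwa [abs_of_nonpos h, ← unitVal_neg] at hw, fun v => ?_⟩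
    obtain ⟨n, hn⟩ := hg v
    refine ⟨n, ?_⟩
    rcases Int.even_or_odd n with he | ho
    · rwa [he.neg_zpow]
    · rw [ho.neg_zpow, neg_neg]
      exact hn.symm

theorem IsFundamentalUnit.le {d : ℕ} {u v : (𝓞 (QSqrt d))ˣ} (hu : IsFundamentalUnit d u)
    (hv : 1 < unitVal d v) : unitVal d u ≤ unitVal d v := by
  obtain ⟨n, hn⟩ := hu.2 v
  have hpos : 0 < unitVal d u ^ n := zpow_pos (by linarith [hu.1]) n
  rcases hn with hn | hn
  · rw [hn, unitVal_zpow] at hv ⊢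
    have : 0 < n := (one_lt_zpow_iff_right₀ hu.1).1 hv
    simpa using zpow_le_zpow_right₀ hu.1.le (show (1 : ℤ) ≤ n by omega)
  · rw [hn, unitVal_neg, unitVal_zpow] at hv
    linarith

theorem IsFundamentalUnit.unique {d : ℕ} {u v : (𝓞 (QSqrt d))ˣ} (hu : IsFundamentalUnit d u)
    (hv : IsFundamentalUnit d v) : u = v :=
  unitVal_injective d (le_antisymm (hu.le hv.1) (hv.le hu.1))

theorem fundamentalUnit_eq {d : ℕ} {u : (𝓞 (QSqrt d))ˣ} (hu : IsFundamentalUnit d u) :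
    fundamentalUnit d = unitVal d u := by
  rw [fundamentalUnit, (Classical.epsilon_spec ⟨u, hu⟩ : IsFundamentalUnit d _).unique hu]

/-- The primes `p ≡ 1 (mod 4)` for which `2` has multiplicative order `(p - 1) / 2` modulo `p`. -/
def P21 : Set ℕ :=
  {p | p.Prime ∧ p % 4 = 1 ∧ orderOf (2 : ZMod p) = (p - 1) / 2}

/-- `β = (log p + 2 h log ε) / ((p - 1) log 2)`, with `h` the class number and `ε > 1` the
fundamental unit of `ℚ(√p)`. -/
noncomputable def beta (p : ℕ) : ℝ :=
  (Real.log p + 2 * (NumberField.classNumber (QSqrt p) : ℝ) * Real.log (fundamentalUnit p)) /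
    (((p : ℝ) - 1) * Real.log 2)

end ThueMorse

/-!
By the analytic class number formula, `2 h log ε = √p * L(1, χ)` with `χ = (· / p)`, so
`β(p) > 1/2` forces `L(1, χ)` to be of order `√p`. Since primes `q` with `χ q = -1` are inert in
`K = ℚ(√p)`, comparing Euler factors gives `ζ_K(s) ≤ ζ(s) L(s, χ)` for `s > 1`, and this inequality
is all that is needed to bound the residue of `ζ_K` by `L(1, χ)`. As `χ` is even, its sums vanish
over both halves of a period, so its partial sums are at most `p / 4` and Abel summation gives
`L(1, χ) ≤ 1 + log (p / 4)`, which settles `p ≥ 289`. For `29 ≤ p < 289` it is enough to sum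
`χ n / n` over one full period and bound the tail by `1/4`. At `5`, `13` and `17`, bounding trace
and discriminant of a unit from below gives `ε ≥ 3 / 2`, `3` and `4` respectively, whence
`β(p) > 1/2`; modulo `5` and `13`, however, `2` is not a square.
-/

namespace ThueMorse

section SummationByParts

/-- The upper bound for `∑ n, c n * g n` obtained from a bound `B` for the partial sums of `c` by
summing by parts from `M` onwards. -/
noncomputable def abelBound (c : ℕ → ℝ) (B : ℝ) (g : ℕ → ℝ) (M : ℕ) : ℝ :=
  ∑ n ∈ Finset.range M, c n * g n + (B - ∑ n ∈ Finset.range M, c n) * g M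

variable {c g : ℕ → ℝ} {B : ℝ} {M : ℕ}

theorem abelBound_antitoneOn (hB : ∀ N, ∑ n ∈ Finset.range N, c n ≤ B)
    (hg : AntitoneOn g (Set.Ici M)) : AntitoneOn (abelBound c B g) (Set.Ici M) := by
  refine antitoneOn_of_succ_le Set.ordConnected_Ici fun N _ hN hN' => ?_
  have h := mul_nonneg (sub_nonneg.2 (hB (N + 1))) (sub_nonneg.2 (hg hN hN' (Order.le_succ N)))
  simp only [abelBound, Order.succ_eq_add_one, Finset.sum_range_succ] at h ⊢
  linarith

theorem tsum_le_abelBound (hB : ∀ N, ∑ n ∈ Finset.range N, c n ≤ B)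
    (hg : AntitoneOn g (Set.Ici M)) (hg0 : ∀ n, 0 ≤ g n) (hs : Summable fun n => c n * g n) :
    ∑' n, c n * g n ≤ abelBound c B g M := by
  refine le_of_tendsto hs.hasSum.tendsto_sum_nat ?_
  filter_upwards [Filter.eventually_ge_atTop M] with N hN
  calc ∑ n ∈ Finset.range N, c n * g n ≤ abelBound c B g N :=
        le_add_of_nonneg_right (mul_nonneg (sub_nonneg.2 (hB N)) (hg0 N))
    _ ≤ abelBound c B g M := abelBound_antitoneOn hB hg Set.self_mem_Ici hN hN

theorem abelBound_natCast_le_sum {B : ℕ} (hc0 : c 0 = 0) (hc : ∀ n, c n ≤ 1)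
    (hg : AntitoneOn g (Set.Ici 1)) :
    abelBound c B g (B + 1) ≤ ∑ n ∈ Finset.range B, g (n + 1) := by
  have hterm : ∀ n ∈ Finset.range B, 0 ≤ (1 - c (n + 1)) * (g (n + 1) - g (B + 1)) := fun n hn =>
    mul_nonneg (sub_nonneg.2 (hc _)) (sub_nonneg.2 (hg (by simp) (by simp)
      (by simpa using (Finset.mem_range.1 hn).le)))
  have hsum := Finset.sum_nonneg hterm
  simp only [one_sub_mul, mul_sub, Finset.sum_sub_distrib, ← Finset.sum_mul, Finset.sum_const,
    Finset.card_range, nsmul_eq_mul] at hsum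
  simp only [abelBound, Finset.sum_range_succ', hc0]
  linarith

end SummationByParts

section EulerProduct

variable {α : Type*} [CommMonoidWithZero α] [UniqueFactorizationMonoid α] [Subsingleton αˣ]

open UniqueFactorizationMonoid in
theorem eq_prod_pow_count_factors [DecidableEq α] {a : α} (ha : a ≠ 0) {S : Finset α}
    (hS : ∀ P, Prime P → P ∣ a → P ∈ S) : a = ∏ P ∈ S, P ^ (factors a).count P := by
  have hsub : (factors a).toFinset ⊆ S := fun P hP => by
    rw [Multiset.mem_toFinset] at hP
    exact hS P (prime_of_factor P hP) (dvd_of_mem_factors hP)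
  rw [← Finset.prod_multiset_count_of_subset _ _ hsub]
  exact (associated_iff_eq.1 (factors_prod ha)).symm

theorem sum_le_prod_inv_one_sub (f : α →* ℝ) (hf : ∀ a, 0 ≤ f a) {S T : Finset α}
    (hS : ∀ P ∈ S, f P < 1) (hT0 : 0 ∉ T) (hTS : ∀ a ∈ T, ∀ P, Prime P → P ∣ a → P ∈ S) :
    ∑ a ∈ T, f a ≤ ∏ P ∈ S, (1 - f P)⁻¹ := by
  classical
  let e (a P : α) : ℕ := (UniqueFactorizationMonoid.factors a).count P
  let E (a : α) : ∀ P ∈ S, ℕ := fun P _ => e a P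
  let N : ℕ := T.sup (fun a => (UniqueFactorizationMonoid.factors a).card) + 1
  have hfactor : ∀ a ∈ T, a = ∏ P ∈ S, P ^ e a P := fun a ha =>
    eq_prod_pow_count_factors (ne_of_mem_of_not_mem ha hT0) (hTS a ha)
  have hE_inj : Set.InjOn E T := fun a ha b hb hab => by
    rw [hfactor a ha, hfactor b hb]
    exact Finset.prod_congr rfl fun P hP => by rw [show e a P = e b P from congrFun₂ hab P hP]
  have hE_mem : T.image E ⊆ S.pi fun _ => Finset.range N := by
    simp only [Finset.image_subset_iff, Finset.mem_pi, Finset.mem_range]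
    exact fun a ha P _ => Nat.lt_succ_of_le ((Multiset.count_le_card _ _).trans
      (Finset.le_sup (f := fun a => (UniqueFactorizationMonoid.factors a).card) ha))
  calc ∑ a ∈ T, f a = ∑ a ∈ T, ∏ P ∈ S.attach, f P ^ E a P P.2 :=
        Finset.sum_congr rfl fun a ha => by
          conv_lhs => rw [hfactor a ha, map_prod, ← Finset.prod_attach]
          simp only [map_pow, E]
    _ = ∑ k ∈ T.image E, ∏ P ∈ S.attach, f P ^ k P P.2 :=
        (Finset.sum_image (f := fun k => ∏ P ∈ S.attach, f P ^ k P P.2) hE_inj).symm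
    _ ≤ ∑ k ∈ S.pi fun _ => Finset.range N, ∏ P ∈ S.attach, f P ^ k P P.2 :=
        Finset.sum_le_sum_of_subset_of_nonneg hE_mem fun k _ _ =>
          Finset.prod_nonneg fun P _ => pow_nonneg (hf P) _
    _ = ∏ P ∈ S, ∑ k ∈ Finset.range N, f P ^ k := (Finset.prod_sum S _ fun P k => f P ^ k).symm
    _ ≤ ∏ P ∈ S, (1 - f P)⁻¹ := by
        refine Finset.prod_le_prod (fun P _ => Finset.sum_nonneg fun k _ => pow_nonneg (hf P) k)
          fun P hP => ?_
        rw [← tsum_geometric_of_lt_one (hf P) (hS P hP)]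
        exact (summable_geometric_of_lt_one (hf P) (hS P hP)).sum_le_tsum _
          fun k _ => pow_nonneg (hf P) k

end EulerProduct

section NormRpow

variable {K : Type*} [Field K] [NumberField K] {s : ℝ}

variable (K s) in
/-- The function `I ↦ N(I) ^ (-s)` on the ideals of the ring of integers of `K`. -/
noncomputable def normRpow : Ideal (𝓞 K) →* ℝ where
  toFun I := (Ideal.absNorm I : ℝ) ^ (-s)
  map_one' := by simp
  map_mul' I J := by
    rw [map_mul, Nat.cast_mul, Real.mul_rpow (Nat.cast_nonneg _) (Nat.cast_nonneg _)]

theorem normRpow_apply (I : Ideal (𝓞 K)) : normRpow K s I = (Ideal.absNorm I : ℝ) ^ (-s) := rfl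

theorem normRpow_nonneg (I : Ideal (𝓞 K)) : 0 ≤ normRpow K s I :=
  Real.rpow_nonneg (Nat.cast_nonneg _) _

theorem normRpow_of_absNorm_eq_pow {I : Ideal (𝓞 K)} {q k : ℕ} (h : Ideal.absNorm I = q ^ k) :
    normRpow K s I = ((q : ℝ) ^ (-s)) ^ k := by
  rw [normRpow_apply, h, Nat.cast_pow, Real.rpow_pow_comm (Nat.cast_nonneg q)]

theorem normRpow_lt_one_of_prime (hs : 0 < s) {P : Ideal (𝓞 K)} (hP : Prime P) :
    normRpow K s P < 1 := by
  have hP0 : Ideal.absNorm P ≠ 0 := mt Ideal.absNorm_eq_zero_iff.1 hP.ne_zero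
  have hP1 : Ideal.absNorm P ≠ 1 := fun h =>
    hP.not_isUnit (Ideal.isUnit_iff.2 (Ideal.absNorm_eq_one_iff.1 h))
  exact Real.rpow_lt_one_of_one_lt_of_neg (by norm_cast; omega) (neg_lt_zero.2 hs)

end NormRpow

section QuadraticSplitting

variable {K : Type*} [Field K] [NumberField K] {p q : ℕ} {θ : 𝓞 K} {P : Ideal (𝓞 K)} {s : ℝ}

theorem absNorm_eq_prime_or_sq (hK : Module.finrank ℚ K = 2) (hq : q.Prime) (hP : Prime P)
    (hqP : (q : 𝓞 K) ∈ P) : Ideal.absNorm P = q ∨ Ideal.absNorm P = q ^ 2 := by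
  have hdvd : Ideal.absNorm P ∣ q ^ 2 := by
    rw [← hK, ← NumberField.RingOfIntegers.rank K, ← Ideal.absNorm_span_natCast]
    exact map_dvd _ (Ideal.dvd_span_singleton.2 hqP)
  obtain ⟨k, hk, h⟩ := (Nat.dvd_prime_pow hq).1 hdvd
  interval_cases k
  · rw [pow_zero, Ideal.absNorm_eq_one_iff] at h
    exact absurd (Ideal.isUnit_iff.2 h) hP.not_isUnit
  · exact .inl (by rw [h, pow_one])
  · exact .inr h

theorem prod_absNorm_dvd_sq (hK : Module.finrank ℚ K = 2) (q : ℕ) {T : Finset (Ideal (𝓞 K))}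
    (hT : ∀ P ∈ T, Prime P ∧ (q : 𝓞 K) ∈ P) : ∏ P ∈ T, Ideal.absNorm P ∣ q ^ 2 := by
  rw [← hK, ← NumberField.RingOfIntegers.rank K, ← Ideal.absNorm_span_natCast, ← map_prod]
  exact map_dvd _ (Finset.prod_primes_dvd _ (fun P hP => (hT P hP).1)
    fun P hP => Ideal.dvd_span_singleton.2 (hT P hP).2)

theorem card_le_two_of_mem_prime (hK : Module.finrank ℚ K = 2) (hq : q.Prime)
    {T : Finset (Ideal (𝓞 K))} (hT : ∀ P ∈ T, Prime P ∧ (q : 𝓞 K) ∈ P) : T.card ≤ 2 := by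
  rw [← Nat.pow_dvd_pow_iff_le_right hq.one_lt, ← Finset.prod_const]
  refine (Finset.prod_dvd_prod_of_dvd _ _ fun P hP => ?_).trans (prod_absNorm_dvd_sq hK q hT)
  rcases absNorm_eq_prime_or_sq hK hq (hT P hP).1 (hT P hP).2 with h | h <;> rw [h]
  exact dvd_pow_self _ two_ne_zero

theorem card_le_one_of_absNorm_eq_sq (hK : Module.finrank ℚ K = 2) (hq : q.Prime)
    {T : Finset (Ideal (𝓞 K))} (hT : ∀ P ∈ T, Prime P ∧ (q : 𝓞 K) ∈ P)
    (hN : ∀ P ∈ T, Ideal.absNorm P = q ^ 2) : T.card ≤ 1 := by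
  have hdvd := prod_absNorm_dvd_sq hK q hT
  rw [Finset.prod_congr rfl hN, Finset.prod_const, ← pow_mul,
    Nat.pow_dvd_pow_iff_le_right hq.one_lt] at hdvd
  omega

theorem exists_intCast_sub_mem_of_absNorm_prime (hP : (Ideal.absNorm P).Prime) (x : 𝓞 K) :
    ∃ n : ℤ, x - n ∈ P := by
  have : Fact (Ideal.absNorm P).Prime := ⟨hP⟩
  have hcard : Nat.card (𝓞 K ⧸ P) = Ideal.absNorm P := by
    rw [Ideal.absNorm_apply, Submodule.cardQuot_apply]
  have hone : (1 : 𝓞 K ⧸ P) ≠ 0 := by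
    rw [← map_one (Ideal.Quotient.mk P), Ne, Ideal.Quotient.eq_zero_iff_mem,
      ← Ideal.eq_top_iff_one, ← Ideal.absNorm_eq_one_iff]
    exact hP.ne_one
  obtain ⟨n, hn⟩ := AddSubgroup.mem_zmultiples_iff.1
    (mem_zmultiples_of_prime_card hcard hone (g' := Ideal.Quotient.mk P x))
  refine ⟨n, Ideal.Quotient.eq_zero_iff_mem.1 ?_⟩
  rw [map_sub, ← hn, map_intCast, zsmul_one, sub_self]

theorem exists_dvd_of_absNorm_eq (hq : q.Prime) (hN : Ideal.absNorm P = q) {m : ℤ}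
    (hθ : θ ^ 2 = θ + m) : ∃ n : ℤ, (q : ℤ) ∣ n ^ 2 - n - m := by
  subst hN
  obtain ⟨n, hn⟩ := exists_intCast_sub_mem_of_absNorm_prime hq θ
  refine ⟨n, ?_⟩
  rw [← Ideal.mem_span_singleton, Ideal.span_singleton_absNorm hq, Ideal.mem_comap]
  have : algebraMap ℤ (𝓞 K) (n ^ 2 - n - m) = (1 - n - θ) * (θ - n) := by
    push_cast [eq_intCast]
    linear_combination hθ
  rw [this]
  exact P.mul_mem_left _ hn

theorem legendreSym_ne_neg_one_of_dvd [Fact p.Prime] (hp : p % 4 = 1) (hq : q.Prime) {n : ℤ}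
    (hn : (q : ℤ) ∣ n ^ 2 - n - (p / 4 : ℕ)) : legendreSym p q ≠ -1 := by
  have : Fact q.Prime := ⟨hq⟩
  have hp4 : (p : ℤ) = 4 * (p / 4 : ℕ) + 1 := by omega
  rcases eq_or_ne q 2 with rfl | hq2
  · have heven : Even (n ^ 2 - n) := by
      rw [sq, ← mul_sub_one]; exact Int.even_mul_pred_self n
    have hp8 : p % 8 = 1 := by
      have := (Int.even_sub.1 (even_iff_two_dvd.2 hn)).1 heven
      obtain ⟨k, hk⟩ := this
      omega
    rw [Nat.cast_ofNat, legendreSym.at_two (by rintro rfl; omega),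
      ZMod.χ₈_nat_eq_if_mod_eight]
    simp [hp8, show p % 2 = 1 by omega]
  · rw [← legendreSym.quadratic_reciprocity_one_mod_four hp hq2, Ne, legendreSym.eq_neg_one_iff,
      not_not]
    refine ⟨(2 * n - 1 : ℤ), ?_⟩
    rw [← Int.cast_mul, ZMod.intCast_eq_intCast_iff_dvd_sub]
    exact (hn.mul_left 4).trans (dvd_of_eq (by rw [hp4]; ring))

theorem absNorm_eq_sq_of_legendreSym (hK : Module.finrank ℚ K = 2) [Fact p.Prime]
    (hp : p % 4 = 1) (hθ : θ ^ 2 = θ + (p / 4 : ℕ)) (hq : q.Prime) (hχ : legendreSym p q = -1)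
    (hP : Prime P) (hqP : (q : 𝓞 K) ∈ P) : Ideal.absNorm P = q ^ 2 := by
  refine (absNorm_eq_prime_or_sq hK hq hP hqP).resolve_left fun hN => ?_
  obtain ⟨n, hn⟩ := exists_dvd_of_absNorm_eq hq hN (m := (p / 4 : ℕ)) (by exact_mod_cast hθ)
  exact legendreSym_ne_neg_one_of_dvd hp hq hn hχ

theorem eq_span_of_sq_mem (hK : Module.finrank ℚ K = 2) (hp : p.Prime) {α : 𝓞 K}
    (hα : α ^ 2 = p) (hP : Prime P) (hpP : (p : 𝓞 K) ∈ P) : P = Ideal.span {α} := by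
  have hαP : P ∣ Ideal.span {α} :=
    Ideal.dvd_span_singleton.2 ((Ideal.isPrime_of_prime hP).mem_of_pow_mem 2 (by rwa [hα]))
  have hN : Ideal.absNorm (Ideal.span {α}) = p := by
    refine Nat.pow_left_injective two_ne_zero ?_
    simp only
    rw [← map_pow, Ideal.span_singleton_pow, hα, Ideal.absNorm_span_natCast,
      NumberField.RingOfIntegers.rank, hK]
  have hα0 : Ideal.span {α} ≠ ⊥ := fun h => hp.ne_zero (by rw [← hN, h, Ideal.absNorm_bot])
  have hαprime : Prime (Ideal.span {α}) := Ideal.prime_of_isPrime hα0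
    (Ideal.isPrime_of_irreducible_absNorm (by rw [hN]; exact hp))
  exact associated_iff_eq.1 (hP.associated_of_dvd hαprime hαP)

theorem prod_inv_one_sub_normRpow_le {T : Finset (Ideal (𝓞 K))} {y : ℝ} {k : ℕ} (hy : y < 1)
    (hy0 : 0 ≤ y) (hT : ∀ P ∈ T, normRpow K s P ≤ y) (hk : T.card ≤ k) :
    ∏ P ∈ T, (1 - normRpow K s P)⁻¹ ≤ (1 - y)⁻¹ ^ k :=
  calc ∏ P ∈ T, (1 - normRpow K s P)⁻¹ ≤ ∏ _P ∈ T, (1 - y)⁻¹ :=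
        Finset.prod_le_prod (fun P hP => inv_nonneg.2 (by linarith [hT P hP]))
          fun P hP => inv_anti₀ (by linarith) (by linarith [hT P hP])
    _ = (1 - y)⁻¹ ^ T.card := Finset.prod_const _
    _ ≤ (1 - y)⁻¹ ^ k :=
        pow_le_pow_right₀ ((one_le_inv₀ (by linarith)).2 (by linarith)) hk

theorem local_factor_le (hK : Module.finrank ℚ K = 2) [Fact p.Prime] (hp : p % 4 = 1)
    (hθ : θ ^ 2 = θ + (p / 4 : ℕ)) (hq : q.Prime) (hs : 0 < s) {T : Finset (Ideal (𝓞 K))}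
    (hT : ∀ P ∈ T, Prime P ∧ (q : 𝓞 K) ∈ P) :
    ∏ P ∈ T, (1 - normRpow K s P)⁻¹ ≤
      (1 - (q : ℝ) ^ (-s))⁻¹ * (1 - (legendreSym p q : ℝ) * (q : ℝ) ^ (-s))⁻¹ := by
  set x : ℝ := (q : ℝ) ^ (-s)
  have hx0 : 0 ≤ x := Real.rpow_nonneg (Nat.cast_nonneg q) _
  have hx1 : x < 1 :=
    Real.rpow_lt_one_of_one_lt_of_neg (Nat.one_lt_cast.2 hq.one_lt) (neg_lt_zero.2 hs)
  have hle : ∀ P ∈ T, normRpow K s P ≤ x := fun P hP => by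
    rcases absNorm_eq_prime_or_sq hK hq (hT P hP).1 (hT P hP).2 with h | h
    · rw [normRpow_of_absNorm_eq_pow (q := q) (k := 1) (by rw [h, pow_one]), pow_one]
    · rw [normRpow_of_absNorm_eq_pow h]
      exact pow_le_of_le_one hx0 hx1.le two_ne_zero
  by_cases ramified : ((q : ℤ) : ZMod p) = 0
  · obtain rfl : p = q := (Nat.prime_dvd_prime_iff_eq Fact.out hq).1
      ((ZMod.natCast_eq_zero_iff q p).1 (by exact_mod_cast ramified))
    have hα : (2 * θ - 1) ^ 2 = (p : 𝓞 K) := by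
      rw [show (p : 𝓞 K) = 4 * (p / 4 : ℕ) + 1 by norm_cast; omega]
      linear_combination 4 * hθ
    have hcard : T.card ≤ 1 := Finset.card_le_one.2 fun P hP Q hQ => by
      rw [eq_span_of_sq_mem hK hq hα (hT P hP).1 (hT P hP).2,
        eq_span_of_sq_mem hK hq hα (hT Q hQ).1 (hT Q hQ).2]
    rw [(legendreSym.eq_zero_iff p p).2 ramified]
    simpa using prod_inv_one_sub_normRpow_le hx1 hx0 hle hcard
  rcases legendreSym.eq_one_or_neg_one p ramified with split | inert
  · rw [split, Int.cast_one, one_mul, ← sq]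
    exact prod_inv_one_sub_normRpow_le hx1 hx0 hle (card_le_two_of_mem_prime hK hq hT)
  · have hN : ∀ P ∈ T, Ideal.absNorm P = q ^ 2 := fun P hP =>
      absNorm_eq_sq_of_legendreSym hK hp hθ hq inert (hT P hP).1 (hT P hP).2
    have hprod := prod_inv_one_sub_normRpow_le (pow_lt_one₀ hx0 hx1 two_ne_zero) (sq_nonneg x)
      (fun P hP => (normRpow_of_absNorm_eq_pow (hN P hP)).le)
      (card_le_one_of_absNorm_eq_sq hK hq hT hN)
    rw [inert, ← mul_inv]
    refine hprod.trans_eq ?_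
    push_cast
    ring_nf

end QuadraticSplitting

section Zeta

open Filter Topology

variable {K : Type*} [Field K] [NumberField K] {s : ℝ}

variable (K) in
/-- The number of ideals of norm `n`, the `n`-th coefficient of the Dedekind zeta function. -/
noncomputable def idealCount (n : ℕ) : ℕ := Nat.card {I : Ideal (𝓞 K) // Ideal.absNorm I = n}

theorem dedekindZeta_eq_ofReal_tsum (hs : s ≠ 0) :
    NumberField.dedekindZeta K s = ((∑' n : ℕ, (idealCount K n : ℝ) * (n : ℝ) ^ (-s) : ℝ) : ℂ) := by
  rw [NumberField.dedekindZeta, LSeries, Complex.ofReal_tsum]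
  refine tsum_congr fun n => ?_
  rcases eq_or_ne n 0 with rfl | hn
  · simp [Real.zero_rpow (neg_ne_zero.2 hs)]
  · rw [LSeries.term_of_ne_zero hn, Real.rpow_neg (Nat.cast_nonneg _)]
    push_cast
    rw [Complex.ofReal_cpow (Nat.cast_nonneg _), div_eq_mul_inv]
    simp [idealCount]

variable (K) in
/-- The nonzero ideals of norm less than `N`. -/
noncomputable def idealsBelow (N : ℕ) : Finset (Ideal (𝓞 K)) :=
  ((Ideal.finite_setOfPred_absNorm_le N).subset (t := {I | I ≠ 0 ∧ Ideal.absNorm I < N})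
    fun _ hI => hI.2.le).toFinset

theorem mem_idealsBelow {N : ℕ} {I : Ideal (𝓞 K)} :
    I ∈ idealsBelow K N ↔ I ≠ 0 ∧ Ideal.absNorm I < N :=
  Set.Finite.mem_toFinset _

variable (K) in
/-- The nonzero prime ideals of norm less than `N`. -/
noncomputable def primeIdealsBelow (N : ℕ) : Finset (Ideal (𝓞 K)) :=
  ((Ideal.finite_setOfPred_absNorm_le N).subset (t := {P | Prime P ∧ Ideal.absNorm P < N})
    fun _ hP => hP.2.le).toFinset

theorem mem_primeIdealsBelow {N : ℕ} {P : Ideal (𝓞 K)} :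
    P ∈ primeIdealsBelow K N ↔ Prime P ∧ Ideal.absNorm P < N :=
  Set.Finite.mem_toFinset _

theorem sum_idealCount_eq_sum_normRpow (hs : s ≠ 0) (N : ℕ) :
    ∑ n ∈ Finset.range N, (idealCount K n : ℝ) * (n : ℝ) ^ (-s) =
      ∑ I ∈ idealsBelow K N, normRpow K s I := by
  rw [← Finset.sum_fiberwise_of_maps_to (t := Finset.range N) (g := Ideal.absNorm)
    fun I hI => Finset.mem_range.2 (mem_idealsBelow.1 hI).2]
  refine Finset.sum_congr rfl fun n hn => ?_
  rw [Finset.sum_congr rfl fun I hI => by rw [normRpow_apply, (Finset.mem_filter.1 hI).2],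
    Finset.sum_const, nsmul_eq_mul]
  rcases eq_or_ne n 0 with rfl | hn0
  · simp [Real.zero_rpow (neg_ne_zero.2 hs)]
  congr 2
  refine Nat.subtype_card _ fun I => ?_
  rw [Finset.mem_filter, mem_idealsBelow]
  refine ⟨And.right, fun hI => ⟨⟨?_, hI ▸ Finset.mem_range.1 hn⟩, hI⟩⟩
  rintro rfl
  exact hn0 (by rw [← hI, Ideal.zero_eq_bot, Ideal.absNorm_bot])

theorem minFac_absNorm_prime_and_mem {P : Ideal (𝓞 K)} (hP : Prime P) :
    (Ideal.absNorm P).minFac.Prime ∧ ((Ideal.absNorm P).minFac : 𝓞 K) ∈ P := by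
  have : P.IsMaximal := (Ideal.isPrime_of_prime hP).isMaximal hP.ne_zero
  obtain ⟨q, n, hn, hqP, hq, hN⟩ := Ideal.exists_prime_and_absNorm_eq_pow P
  rw [hN, hq.pow_minFac hn.ne']
  exact ⟨hq, hqP⟩

theorem sum_idealCount_le_prod_prod (hs : 0 < s) (N : ℕ) :
    ∑ n ∈ Finset.range N, (idealCount K n : ℝ) * (n : ℝ) ^ (-s) ≤
      ∏ q ∈ N.primesBelow, ∏ P ∈ primeIdealsBelow K N with (Ideal.absNorm P).minFac = q,
        (1 - normRpow K s P)⁻¹ := by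
  have hmaps : ∀ P ∈ primeIdealsBelow K N, (Ideal.absNorm P).minFac ∈ N.primesBelow := by
    intro P hP
    obtain ⟨hP, hlt⟩ := mem_primeIdealsBelow.1 hP
    have hpos := Nat.pos_of_ne_zero (mt Ideal.absNorm_eq_zero_iff.1 hP.ne_zero)
    exact Nat.mem_primesBelow.2
      ⟨(Nat.minFac_le hpos).trans_lt hlt, (minFac_absNorm_prime_and_mem hP).1⟩
  rw [sum_idealCount_eq_sum_normRpow hs.ne', Finset.prod_fiberwise_of_maps_to hmaps]
  refine sum_le_prod_inv_one_sub (normRpow K s) normRpow_nonneg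
    (fun P hP => normRpow_lt_one_of_prime hs (mem_primeIdealsBelow.1 hP).1)
    (fun h => (mem_idealsBelow.1 h).1 rfl) fun I hI P hP hdvd => ?_
  obtain ⟨hI0, hlt⟩ := mem_idealsBelow.1 hI
  have hpos := Nat.pos_of_ne_zero (mt Ideal.absNorm_eq_zero_iff.1 hI0)
  exact mem_primeIdealsBelow.2
    ⟨hP, (Nat.le_of_dvd hpos (map_dvd Ideal.absNorm hdvd)).trans_lt hlt⟩

theorem summable_rpow_neg (hs : 1 < s) : Summable fun n : ℕ => (n : ℝ) ^ (-s) :=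
  Real.summable_nat_rpow.2 (neg_lt_neg hs)

/-- The function `n ↦ n ^ (-s)`. -/
noncomputable def natRpowHom (hs : s ≠ 0) : ℕ →*₀ ℝ where
  toFun n := (n : ℝ) ^ (-s)
  map_zero' := by rw [Nat.cast_zero, Real.zero_rpow (neg_ne_zero.2 hs)]
  map_one' := by rw [Nat.cast_one, Real.one_rpow]
  map_mul' m n := by rw [Nat.cast_mul, Real.mul_rpow (Nat.cast_nonneg _) (Nat.cast_nonneg _)]

variable (p : ℕ) [Fact p.Prime]

/-- The function `n ↦ (n / p) n ^ (-s)`. -/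
noncomputable def legendreRpowHom (s : ℝ) : ℕ →*₀ ℝ where
  toFun n := (legendreSym p n : ℝ) * (n : ℝ) ^ (-s)
  map_zero' := by simp [legendreSym.at_zero]
  map_one' := by simp [legendreSym.at_one]
  map_mul' m n := by
    rw [Nat.cast_mul, Nat.cast_mul, Real.mul_rpow (Nat.cast_nonneg _) (Nat.cast_nonneg _),
      legendreSym.mul]
    push_cast; ring

theorem abs_legendreSym_le_one (a : ℤ) : |legendreSym p a| ≤ 1 := by
  by_cases h : (a : ZMod p) = 0
  · simp [(legendreSym.eq_zero_iff p a).2 h]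
  · rcases legendreSym.eq_one_or_neg_one p h with h | h <;> simp [h]

theorem summable_norm_legendreSym_mul_rpow (hs : 1 < s) :
    Summable fun n : ℕ => ‖(legendreSym p n : ℝ) * (n : ℝ) ^ (-s)‖ := by
  refine (summable_rpow_neg hs).of_nonneg_of_le (fun _ => norm_nonneg _) fun n => ?_
  have h0 : (0 : ℝ) ≤ (n : ℝ) ^ (-s) := Real.rpow_nonneg (Nat.cast_nonneg _) _
  rw [norm_mul, Real.norm_of_nonneg h0]
  refine mul_le_of_le_one_left h0 ?_
  rw [Real.norm_eq_abs]
  exact_mod_cast abs_legendreSym_le_one p n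

theorem tsum_idealCount_le (hK : Module.finrank ℚ K = 2) {p : ℕ} [Fact p.Prime] (hp : p % 4 = 1)
    {θ : 𝓞 K} (hθ : θ ^ 2 = θ + (p / 4 : ℕ)) (hs : 1 < s) :
    ∑' n : ℕ, (idealCount K n : ℝ) * (n : ℝ) ^ (-s) ≤
      (∑' n : ℕ, (n : ℝ) ^ (-s)) * ∑' n : ℕ, (legendreSym p n : ℝ) * (n : ℝ) ^ (-s) := by
  have hs0 : 0 < s := by linarith
  have hnn (n : ℕ) : 0 ≤ (idealCount K n : ℝ) * (n : ℝ) ^ (-s) :=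
    mul_nonneg (Nat.cast_nonneg _) (Real.rpow_nonneg (Nat.cast_nonneg _) _)
  have hzeta := EulerProduct.eulerProduct_completely_multiplicative (f := natRpowHom hs0.ne')
    (summable_rpow_neg hs).norm
  have hL := EulerProduct.eulerProduct_completely_multiplicative (f := legendreRpowHom p s)
    (summable_norm_legendreSym_mul_rpow p hs)
  refine Real.tsum_le_of_sum_range_le hnn fun N => ?_
  refine ge_of_tendsto (hzeta.mul hL) ((eventually_ge_atTop N).mono fun M hM => ?_)
  calc ∑ n ∈ Finset.range N, (idealCount K n : ℝ) * (n : ℝ) ^ (-s)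
      ≤ ∑ n ∈ Finset.range M, (idealCount K n : ℝ) * (n : ℝ) ^ (-s) :=
        Finset.sum_le_sum_of_subset_of_nonneg (Finset.range_mono hM) fun n _ _ => hnn n
    _ ≤ _ := sum_idealCount_le_prod_prod hs0 M
    _ ≤ _ := Finset.prod_le_prod
        (fun q _ => Finset.prod_nonneg fun P hP => inv_nonneg.2 (sub_nonneg.2
          (normRpow_lt_one_of_prime hs0 (mem_primeIdealsBelow.1 (Finset.mem_filter.1 hP).1).1).le))
        fun q hq => local_factor_le hK hp hθ (Nat.prime_of_mem_primesBelow hq) hs0 fun P hP => by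
          obtain ⟨hPM, rfl⟩ := Finset.mem_filter.1 hP
          have hprime := (mem_primeIdealsBelow.1 hPM).1
          exact ⟨hprime, (minFac_absNorm_prime_and_mem hprime).2⟩
    _ = _ := Finset.prod_mul_distrib

end Zeta

section LegendreSums

theorem two_mul_sum_Ico_le_of_sum_eq_zero {f : ℕ → ℤ} (hf : ∀ n, |f n| ≤ 1) {a b N : ℕ}
    (h0 : ∑ n ∈ Finset.Ico a b, f n = 0) (ha : a ≤ N) (hb : N ≤ b) :
    2 * ∑ n ∈ Finset.Ico a N, f n ≤ (b - a : ℕ) := by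
  have hleft := Finset.abs_sum_le_sum_abs f (Finset.Ico a N)
  have hright := Finset.abs_sum_le_sum_abs f (Finset.Ico N b)
  have hcard := fun c d => Finset.sum_le_card_nsmul (Finset.Ico c d) _ 1 fun n _ => hf n
  simp only [Nat.card_Ico, nsmul_one] at hcard
  have h1 := (le_abs_self _).trans (hleft.trans (hcard a N))
  have h2 := (neg_le_abs _).trans (hright.trans (hcard N b))
  have h3 := Finset.sum_Ico_consecutive f ha hb
  omega

theorem sum_range_mod_of_periodic {M : Type*} [AddCommMonoid M] {f : ℕ → M} {p : ℕ}
    (hf : f.Periodic p) (h0 : ∑ n ∈ Finset.range p, f n = 0) (N : ℕ) :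
    ∑ n ∈ Finset.range (N % p), f n = ∑ n ∈ Finset.range N, f n := by
  have hmul (k : ℕ) : ∑ n ∈ Finset.range (p * k), f n = 0 := by
    induction k with
    | zero => simp
    | succ k ih =>
      rw [Nat.mul_succ, Nat.add_comm, Finset.sum_range_add, h0, zero_add, ← ih]
      exact Finset.sum_congr rfl fun n _ => by rw [Nat.add_comm, hf]
  conv_rhs => rw [← Nat.div_add_mod N p, Finset.sum_range_add, hmul, zero_add]
  refine Finset.sum_congr rfl fun n _ => ?_
  rw [Nat.add_comm, Nat.mul_comm]
  exact (hf.nat_mul (N / p) n).symm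

variable {p : ℕ} [Fact p.Prime]

theorem legendreSym_natCast_periodic : (fun n : ℕ => legendreSym p n).Periodic p := fun n => by
  simp [legendreSym]

theorem sum_range_legendreSym_eq_zero (hp : p ≠ 2) :
    ∑ n ∈ Finset.range p, legendreSym p n = 0 := by
  rw [← quadraticChar_sum_zero (F := ZMod p) (by rwa [ZMod.ringChar_zmod_n])]
  refine Finset.sum_bij (fun n _ => (n : ZMod p)) (fun _ _ => Finset.mem_univ _) ?_ ?_ ?_
  · intro m hm n hn hmn
    rw [ZMod.natCast_eq_natCast_iff] at hmn
    exact Nat.ModEq.eq_of_lt_of_lt hmn (Finset.mem_range.1 hm) (Finset.mem_range.1 hn)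
  · intro x _
    exact ⟨x.val, Finset.mem_range.2 x.val_lt, by simp⟩
  · intro n _
    simp [legendreSym]

theorem legendreSym_sub_eq (hp : p % 4 = 1) (a : ℤ) :
    legendreSym p (p - a) = legendreSym p a := by
  have hneg : legendreSym p (-1) = 1 := by
    rw [legendreSym.at_neg_one (by rintro rfl; omega), ZMod.χ₄_nat_one_mod_four hp]
  calc legendreSym p (p - a) = legendreSym p (-1 * a) := by simp [legendreSym]
    _ = legendreSym p a := by rw [legendreSym.mul, hneg, one_mul]

theorem sum_Ico_half_legendreSym_eq_zero (hp : p % 4 = 1) :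
    ∑ n ∈ Finset.Ico 1 (p / 2 + 1), legendreSym p n = 0 ∧
      ∑ n ∈ Finset.Ico (p / 2 + 1) p, legendreSym p n = 0 := by
  have hreflect : ∑ n ∈ Finset.Ico (p / 2 + 1) p, legendreSym p n =
      ∑ n ∈ Finset.Ico 1 (p / 2 + 1), legendreSym p n := by
    have h := Finset.sum_Ico_reflect (fun n : ℕ => legendreSym p n) 1
      (show p / 2 + 1 ≤ p + 1 by omega)
    rw [show p + 1 - (p / 2 + 1) = p / 2 + 1 by omega, Nat.add_sub_cancel] at h
    rw [← h]
    refine Finset.sum_congr rfl fun n hn => ?_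
    rw [Nat.cast_sub (by have := Finset.mem_Ico.1 hn; omega), legendreSym_sub_eq hp]
  have htotal := sum_range_legendreSym_eq_zero (p := p) (by rintro rfl; omega)
  rw [Finset.range_eq_Ico, Finset.sum_eq_sum_Ico_succ_bot (by omega), Nat.cast_zero,
    legendreSym.at_zero, zero_add, zero_add,
    ← Finset.sum_Ico_consecutive _ (show 1 ≤ p / 2 + 1 by omega) (by omega)] at htotal
  omega

theorem sum_range_legendreSym_le (hp : p % 4 = 1) (N : ℕ) :
    ∑ n ∈ Finset.range N, legendreSym p n ≤ (p / 4 : ℕ) := by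
  obtain ⟨hleft, hright⟩ := sum_Ico_half_legendreSym_eq_zero hp
  rw [← sum_range_mod_of_periodic legendreSym_natCast_periodic
    (sum_range_legendreSym_eq_zero (by rintro rfl; omega))]
  have hlt := Nat.mod_lt N (show p > 0 by omega)
  generalize N % p = r at hlt ⊢
  rcases r.eq_zero_or_pos with rfl | hr
  · exact Int.natCast_nonneg _
  rw [Finset.range_eq_Ico, Finset.sum_eq_sum_Ico_succ_bot hr, Nat.cast_zero,
    legendreSym.at_zero, zero_add, zero_add]
  have habs (n : ℕ) := abs_legendreSym_le_one p n
  rcases le_total r (p / 2 + 1) with h | h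
  · have := two_mul_sum_Ico_le_of_sum_eq_zero habs hleft hr h
    omega
  · have := two_mul_sum_Ico_le_of_sum_eq_zero habs hright h hlt.le
    rw [← Finset.sum_Ico_consecutive _ (show 1 ≤ p / 2 + 1 by omega) h, hleft, zero_add]
    omega

end LegendreSums

section Residue

open Filter Topology

variable {p : ℕ} [Fact p.Prime] {M : ℕ}

/-- The upper bound `abelBound` for the value at `1` of the `L`-function of `(· / p)`, for
`p ≡ 1 (mod 4)`: by reflection at `p / 2` the sums of Legendre symbols are at most `p / 4`. -/
noncomputable def legendreBound (p : ℕ) [Fact p.Prime] (M : ℕ) : ℝ :=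
  abelBound (fun n => (legendreSym p n : ℝ)) (p / 4 : ℕ) (fun n => (n : ℝ)⁻¹) M

theorem tsum_legendreSym_mul_rpow_le_abelBound (hp : p % 4 = 1) (hM : 1 ≤ M) {s : ℝ}
    (hs : 1 < s) : ∑' n : ℕ, (legendreSym p n : ℝ) * (n : ℝ) ^ (-s) ≤
      abelBound (fun n => (legendreSym p n : ℝ)) (p / 4 : ℕ) (fun n => (n : ℝ) ^ (-s)) M := by
  refine tsum_le_abelBound (fun N => ?_) (fun m hm n _ hmn => ?_)
    (fun n => Real.rpow_nonneg (Nat.cast_nonneg _) _)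
    (summable_norm_legendreSym_mul_rpow p hs).of_norm
  · rw [← Int.cast_sum, ← Int.cast_natCast]
    exact Int.cast_le.2 (sum_range_legendreSym_le hp N)
  · exact Real.rpow_le_rpow_of_nonpos (Nat.cast_pos.2 (hM.trans hm)) (Nat.cast_le.2 hmn)
      (by linarith)

theorem tendsto_abelBound_rpow_neg {c : ℕ → ℝ} (hc : c 0 = 0) (B : ℝ) (hM : 1 ≤ M) :
    Tendsto (fun s : ℝ => abelBound c B (fun n => (n : ℝ) ^ (-s)) M) (𝓝 1)
      (𝓝 (abelBound c B (fun n => (n : ℝ)⁻¹) M)) := by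
  have hrpow {n : ℕ} (hn : n ≠ 0) :
      Tendsto (fun s : ℝ => (n : ℝ) ^ (-s)) (𝓝 1) (𝓝 (n : ℝ)⁻¹) :=
    ((Real.continuous_const_rpow (Nat.cast_ne_zero.2 hn)).comp continuous_neg).tendsto' 1 _
      (by simp [Real.rpow_neg_one])
  refine (tendsto_finsetSum _ fun n _ => ?_).add ((hrpow (by omega)).const_mul _)
  rcases eq_or_ne n 0 with rfl | hn
  · simp [hc]
  · exact (hrpow hn).const_mul _

theorem tendsto_sub_one_mul_tsum_idealCount (K : Type*) [Field K] [NumberField K] :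
    Tendsto (fun s : ℝ => (s - 1) * ∑' n : ℕ, (idealCount K n : ℝ) * (n : ℝ) ^ (-s))
      (𝓝[>] 1) (𝓝 (NumberField.dedekindZeta_residue K)) := by
  have h := (Complex.continuous_re.tendsto _).comp
    (NumberField.tendsto_sub_one_mul_dedekindZeta_nhdsGT K)
  rw [Complex.ofReal_re] at h
  refine h.congr' ?_
  filter_upwards [self_mem_nhdsWithin] with s (hs : 1 < s)
  rw [Function.comp_apply, dedekindZeta_eq_ofReal_tsum (by positivity)]
  norm_cast

theorem dedekindZeta_residue_le_legendreBound {K : Type*} [Field K] [NumberField K]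
    (hK : Module.finrank ℚ K = 2) (hp : p % 4 = 1) {θ : 𝓞 K} (hθ : θ ^ 2 = θ + (p / 4 : ℕ))
    (hM : 1 ≤ M) : NumberField.dedekindZeta_residue K ≤ legendreBound p M := by
  have hzeta : Tendsto (fun s : ℝ => (s - 1) * ∑' n : ℕ, (n : ℝ) ^ (-s)) (𝓝[>] 1) (𝓝 1) := by
    simpa only [one_div, Real.rpow_neg (Nat.cast_nonneg _)] using tendsto_sub_mul_tsum_nat_rpow
  have hbound := hzeta.mul ((tendsto_abelBound_rpow_neg (c := fun n => (legendreSym p n : ℝ))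
    (by simp [legendreSym.at_zero]) (p / 4 : ℕ) hM).mono_left nhdsWithin_le_nhds)
  rw [one_mul] at hbound
  refine le_of_tendsto_of_tendsto (tendsto_sub_one_mul_tsum_idealCount K) hbound ?_
  filter_upwards [self_mem_nhdsWithin] with s (hs : 1 < s)
  have hzeta0 : 0 ≤ ∑' n : ℕ, (n : ℝ) ^ (-s) :=
    tsum_nonneg fun n => Real.rpow_nonneg (Nat.cast_nonneg _) _
  rw [mul_assoc]
  refine mul_le_mul_of_nonneg_left ((tsum_idealCount_le hK hp hθ hs).trans ?_) (by linarith)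
  exact mul_le_mul_of_nonneg_left (tsum_legendreSym_mul_rpow_le_abelBound hp hM hs) hzeta0

theorem legendreBound_le_one_add_log (p : ℕ) [Fact p.Prime] :
    legendreBound p (p / 4 + 1) ≤ 1 + Real.log (p / 4 : ℕ) := by
  refine (abelBound_natCast_le_sum (by simp [legendreSym.at_zero]) (fun n => ?_)
    fun m hm n _ hmn => inv_anti₀ (Nat.cast_pos.2 hm) (Nat.cast_le.2 hmn)).trans ?_
  · exact_mod_cast (abs_le.1 (abs_legendreSym_le_one p n)).2
  · simpa [harmonic] using harmonic_le_one_add_log (p / 4)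

theorem legendreBound_self (hp : p ≠ 2) :
    legendreBound p p =
      ∑ n ∈ Finset.range p, (legendreSym p n : ℝ) * (n : ℝ)⁻¹ + (p / 4 : ℕ) * (p : ℝ)⁻¹ := by
  rw [legendreBound, abelBound, ← Int.cast_sum, sum_range_legendreSym_eq_zero hp, Int.cast_zero,
    sub_zero]

end Residue

section QuadraticAlgebra

variable {R S : Type*} [CommRing R] [CommRing S] [Algebra R S]

theorem sq_eq_trace_mul_sub_norm [Nontrivial R] (b : Module.Basis (Fin 2) R S) (x : S) :
    x ^ 2 = algebraMap R S (Algebra.trace R S x) * x - algebraMap R S (Algebra.norm R x) := by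
  refine Algebra.leftMulMatrix_injective b ?_
  have h := Matrix.aeval_self_charpoly (Algebra.leftMulMatrix b x)
  rw [Matrix.charpoly_fin_two] at h
  simp only [map_add, map_sub, map_mul, map_pow, Polynomial.aeval_X, Polynomial.aeval_C] at h
  simp only [map_sub, map_mul, map_pow, AlgHom.commutes, Algebra.trace_eq_matrix_trace b,
    Algebra.norm_eq_matrix_det b]
  rw [← sub_eq_zero, ← h]
  abel

theorem discr_one_eq_trace_sq_sub_four_mul_norm [Nontrivial R] (b : Module.Basis (Fin 2) R S)
    (x : S) : Algebra.discr R ![1, x] = Algebra.trace R S x ^ 2 - 4 * Algebra.norm R x := by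
  have := Module.Finite.of_basis b
  have := Module.Free.of_basis b
  have hone : Algebra.trace R S 1 = 2 := by
    rw [Algebra.trace_eq_matrix_trace b, map_one, Matrix.trace_one, Fintype.card_fin, Nat.cast_two]
  have hsq := congrArg (Algebra.trace R S) (sq_eq_trace_mul_sub_norm b x)
  rw [sq, map_sub, ← Algebra.smul_def, map_smul, Algebra.algebraMap_eq_smul_one, map_smul, hone,
    smul_eq_mul, smul_eq_mul] at hsq
  rw [Algebra.discr_def, Matrix.det_fin_two]
  simp only [Algebra.traceMatrix_apply, Algebra.traceForm_apply, Matrix.cons_val_zero,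
    Matrix.cons_val_one, mul_one, one_mul, hone, hsq]
  ring

end QuadraticAlgebra

section QuadraticField

variable {K : Type*} [Field K] [NumberField K]

theorem exists_basis_ringOfIntegers (hK : Module.finrank ℚ K = 2) :
    Nonempty (Module.Basis (Fin 2) ℤ (𝓞 K)) :=
  ⟨Module.finBasisOfFinrankEq ℤ (𝓞 K) ((NumberField.RingOfIntegers.rank K).trans hK)⟩

theorem exists_trace_sq_sub_four_mul_norm_eq (hK : Module.finrank ℚ K = 2) (x : 𝓞 K) :
    ∃ k : ℤ, Algebra.trace ℤ (𝓞 K) x ^ 2 - 4 * Algebra.norm ℤ x =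
      k ^ 2 * NumberField.discr K := by
  obtain ⟨b⟩ := exists_basis_ringOfIntegers hK
  refine ⟨(b.toMatrix ![1, x]).det, ?_⟩
  rw [← discr_one_eq_trace_sq_sub_four_mul_norm b, ← NumberField.discr_eq_discr K b,
    ← Algebra.discr_of_matrix_vecMul, b.toMatrix_map_vecMul]

end QuadraticField

section QSqrt

/-- The element `(1 + √d) / 2` of `ℚ(√d)`. -/
noncomputable def halfOneAddSqrt (d : ℕ) : QSqrt d :=
  (1 + IntermediateField.AdjoinSimple.gen ℚ √(d : ℝ)) / 2

theorem coe_halfOneAddSqrt (d : ℕ) : (halfOneAddSqrt d : ℝ) = (1 + √d) / 2 := rfl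

theorem halfOneAddSqrt_sq {d : ℕ} (hd : d % 4 = 1) :
    halfOneAddSqrt d ^ 2 = halfOneAddSqrt d + (d / 4 : ℕ) := by
  apply Subtype.ext
  have hd4 : (d : ℝ) = 4 * (d / 4 : ℕ) + 1 := by exact_mod_cast (by omega : d = 4 * (d / 4) + 1)
  have hsq := Real.sq_sqrt d.cast_nonneg
  push_cast [coe_halfOneAddSqrt]
  linear_combination hsq / 4 + hd4 / 4

theorem exists_sq_eq_self_add {d : ℕ} (hd : d % 4 = 1) :
    ∃ θ : 𝓞 (QSqrt d), (θ : ℝ) = (1 + √d) / 2 ∧ θ ^ 2 = θ + (d / 4 : ℕ) := by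
  have hint : IsIntegral ℤ (halfOneAddSqrt d) := by
    refine ⟨Polynomial.X ^ 2 - Polynomial.X - Polynomial.C ((d / 4 : ℕ) : ℤ), by monicity!, ?_⟩
    rw [Polynomial.eval₂_sub, Polynomial.eval₂_sub, Polynomial.eval₂_X_pow, Polynomial.eval₂_X,
      Polynomial.eval₂_C, halfOneAddSqrt_sq hd, eq_intCast, Int.cast_natCast]
    ring
  exact ⟨⟨_, hint⟩, rfl, NumberField.RingOfIntegers.ext (halfOneAddSqrt_sq hd)⟩

theorem coe_sq_eq_trace_mul_sub_norm {p : ℕ} (hp : p.Prime) (x : 𝓞 (QSqrt p)) :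
    (x : ℝ) ^ 2 = Algebra.trace ℤ (𝓞 (QSqrt p)) x * x - Algebra.norm ℤ x := by
  obtain ⟨b⟩ := exists_basis_ringOfIntegers (finrank_QSqrt hp)
  have h := congrArg (fun y : 𝓞 (QSqrt p) => ((y : QSqrt p) : ℝ)) (sq_eq_trace_mul_sub_norm b x)
  simpa using h

theorem discr_QSqrt {p : ℕ} (hp : p.Prime) (h4 : p % 4 = 1) :
    NumberField.discr (QSqrt p) = p := by
  obtain ⟨θ, hθ, hθ2⟩ := exists_sq_eq_self_add h4
  obtain ⟨k, hk⟩ := exists_trace_sq_sub_four_mul_norm_eq (finrank_QSqrt hp) θ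
  have hsq := coe_sq_eq_trace_mul_sub_norm hp θ
  set t := Algebra.trace ℤ (𝓞 (QSqrt p)) θ
  set n := Algebra.norm ℤ θ
  have hlin : ((t - 1 : ℤ) : ℝ) * θ = (n + (p / 4 : ℕ) : ℤ) := by
    have h : (θ : ℝ) ^ 2 = θ + (p / 4 : ℕ) := by
      simpa using congrArg (fun y : 𝓞 (QSqrt p) => ((y : QSqrt p) : ℝ)) hθ2
    rw [Int.cast_sub, Int.cast_one, Int.cast_add, Int.cast_natCast]
    linear_combination h - hsq
  have ht : t - 1 = 0 := by
    by_contra ht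
    have hirr : Irrational (θ : ℝ) := by
      rw [hθ]
      exact_mod_cast (hp.irrational_sqrt.natCast_add 1).div_natCast two_ne_zero
    exact (hirr.intCast_mul ht).ne_int _ hlin
  have hn : n + (p / 4 : ℕ) = 0 := by
    rw [ht, Int.cast_zero, zero_mul] at hlin
    exact_mod_cast hlin.symm
  have hk' : (p : ℤ) = k * k * NumberField.discr (QSqrt p) := by
    rw [← sq, ← hk, show t = 1 by omega]
    omega
  have hunit := (Nat.prime_iff_prime_int.1 hp).irreducible.squarefree k ⟨_, hk'⟩
  rw [hk', Int.isUnit_mul_self hunit, one_mul]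

theorem exists_int_of_one_lt_unitVal {p : ℕ} (hp : p.Prime) (h4 : p % 4 = 1)
    {u : (𝓞 (QSqrt p))ˣ} (hu : 1 < unitVal p u) :
    ∃ t n k : ℤ, 0 < t ∧ |n| = 1 ∧ k ≠ 0 ∧ t ^ 2 - 4 * n = k ^ 2 * p ∧
      unitVal p u ^ 2 = t * unitVal p u - n := by
  obtain ⟨k, hk⟩ := exists_trace_sq_sub_four_mul_norm_eq (finrank_QSqrt hp) (u : 𝓞 (QSqrt p))
  have hsq : unitVal p u ^ 2 = _ := coe_sq_eq_trace_mul_sub_norm hp (u : 𝓞 (QSqrt p))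
  have hn := Int.isUnit_iff_abs_eq.1 (u.isUnit.map (Algebra.norm ℤ))
  rw [discr_QSqrt hp h4] at hk
  change unitVal p u ^ 2 = _ * unitVal p u - _ at hsq
  set t := Algebra.trace ℤ (𝓞 (QSqrt p)) u
  set n := Algebra.norm ℤ (u : 𝓞 (QSqrt p))
  have hn1 : |(n : ℝ)| = 1 := by exact_mod_cast hn
  have ht : 0 < t := by
    have h : (0 : ℝ) < t * unitVal p u := by
      nlinarith [(abs_le.1 hn1.le).1]
    exact_mod_cast pos_of_mul_pos_left h (by linarith)
  refine ⟨t, n, k, ht, hn, ?_, hk, hsq⟩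
  rintro rfl
  have hdouble : 2 * unitVal p u - t = 0 := by
    have hk' : (t : ℝ) ^ 2 - 4 * n = 0 := by exact_mod_cast hk.trans (by ring)
    exact pow_eq_zero_iff two_ne_zero |>.1 (by linear_combination 4 * hsq + hk')
  have ht2 : t ≤ 2 := by nlinarith [(abs_le.1 hn.le).2]
  have ht2' : (t : ℝ) ≤ 2 := by exact_mod_cast ht2
  linarith

theorem add_le_two_mul_unitVal {p : ℕ} (hp : p.Prime) (h4 : p % 4 = 1) {a b : ℕ}
    (ha : a ^ 2 + 4 < p) (hb : b ^ 2 ≤ p) {u : (𝓞 (QSqrt p))ˣ} (hu : 1 < unitVal p u) :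
    (a : ℝ) + 1 + b ≤ 2 * unitVal p u := by
  obtain ⟨t, n, k, ht, hn, hk, htnk, hsq⟩ := exists_int_of_one_lt_unitVal hp h4 hu
  obtain ⟨hn1, hn2⟩ := abs_le.1 hn.le
  have hk1 : (1 : ℤ) ≤ k ^ 2 := by have := sq_pos_of_ne_zero hk; omega
  have hkp : (p : ℤ) ≤ k ^ 2 * p := le_mul_of_one_le_left (Int.natCast_nonneg p) hk1
  have hat : (a : ℤ) + 1 ≤ t := lt_of_pow_lt_pow_left₀ 2 ht.le (by zify at ha; omega)
  have hdiff : 0 < 2 * unitVal p u - t := by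
    have hn2' : (n : ℝ) ≤ 1 := by exact_mod_cast hn2
    nlinarith
  have hbv : (b : ℝ) ≤ 2 * unitVal p u - t := by
    refine le_of_sq_le_sq ?_ hdiff.le
    calc (b : ℝ) ^ 2 ≤ p := by exact_mod_cast hb
      _ ≤ (t : ℝ) ^ 2 - 4 * n := by exact_mod_cast hkp.trans_eq htnk.symm
      _ = (2 * unitVal p u - t) ^ 2 := by linear_combination -4 * hsq
  have hat' : (a : ℝ) + 1 ≤ t := by exact_mod_cast hat
  linarith

end QSqrt

section ClassNumberFormula

open NumberField NumberField.InfinitePlace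

theorem nrRealPlaces_QSqrt {p : ℕ} (hp : p.Prime) : nrRealPlaces (QSqrt p) = 2 ∧
    nrComplexPlaces (QSqrt p) = 0 := by
  have hdegree := card_add_two_mul_card_eq_rank (QSqrt p)
  have hcard := card_eq_nrRealPlaces_add_nrComplexPlaces (QSqrt p)
  have hrank := rank_QSqrt hp
  rw [finrank_QSqrt hp] at hdegree
  unfold Units.rank at hrank
  omega

theorem torsionOrder_QSqrt_le_two (d : ℕ) : Units.torsionOrder (QSqrt d) ≤ 2 := by
  classical
  have hsub : (Units.torsion (QSqrt d) : Set (𝓞 (QSqrt d))ˣ) ⊆ {1, -1} :=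
    fun u hu => by simpa using torsion_eq hu
  calc Units.torsionOrder (QSqrt d)
      = (Units.torsion (QSqrt d) : Set (𝓞 (QSqrt d))ˣ).ncard := rfl
    _ ≤ ({1, -1} : Set (𝓞 (QSqrt d))ˣ).ncard := Set.ncard_le_ncard hsub
    _ ≤ 2 := (Set.ncard_insert_le _ _).trans (by simp)

theorem exists_isFundamentalUnit_unitVal_eq {p : ℕ} (hp : p.Prime) :
    ∃ u, IsFundamentalUnit p u ∧ unitVal p u = fundamentalUnit p := by
  obtain ⟨u, hu⟩ := exists_isFundamentalUnit hp
  exact ⟨u, hu, (fundamentalUnit_eq hu).symm⟩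

theorem log_fundamentalUnit_le {p : ℕ} (hp : p.Prime) {v : (𝓞 (QSqrt p))ˣ}
    (hv : v ∉ Units.torsion (QSqrt p)) :
    Real.log (fundamentalUnit p) ≤ |Real.log (|unitVal p v|)| := by
  obtain ⟨u, hu, hε⟩ := exists_isFundamentalUnit_unitVal_eq hp
  obtain ⟨n, hn⟩ := hu.2 v
  have hn0 : n ≠ 0 := by
    rintro rfl
    refine hv (isOfFinOrder_iff_pow_eq_one.2 ⟨2, two_pos, ?_⟩)
    rcases hn with hn | hn <;> simp [hn]
  have hlog : Real.log |unitVal p v| = n * Real.log (unitVal p u) := by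
    rw [Real.log_abs]
    rcases hn with hn | hn
    · rw [hn, unitVal_zpow, Real.log_zpow]
    · rw [hn, unitVal_neg, unitVal_zpow, Real.log_neg_eq_log, Real.log_zpow]
  have hpos := Real.log_pos hu.1
  rw [← hε, hlog, abs_mul, abs_of_pos hpos]
  exact le_mul_of_one_le_left hpos.le (by exact_mod_cast Int.one_le_abs hn0)

theorem exists_infinitePlace_unit_eq_abs_unitVal (d : ℕ) :
    ∃ w : InfinitePlace (QSqrt d), w.mult = 1 ∧
      ∀ u : (𝓞 (QSqrt d))ˣ, w ((u : 𝓞 (QSqrt d)) : QSqrt d) = |unitVal d u| := by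
  let φ : QSqrt d →+* ℂ := Complex.ofRealHom.comp (algebraMap (QSqrt d) ℝ)
  have hφ : ComplexEmbedding.IsReal φ := by
    ext x
    simp [φ]
  refine ⟨mk φ, mult_isReal ⟨_, ⟨φ, hφ, rfl⟩⟩, fun u => ?_⟩
  rw [InfinitePlace.apply]
  simp [φ, unitVal]

theorem log_fundamentalUnit_le_regulator {p : ℕ} (hp : p.Prime) :
    Real.log (fundamentalUnit p) ≤ Units.regulator (QSqrt p) := by
  classical
  obtain ⟨w, hmult, hw⟩ := exists_infinitePlace_unit_eq_abs_unitVal p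
  have hcard : Fintype.card (InfinitePlace (QSqrt p)) = 2 := by
    rw [card_eq_nrRealPlaces_add_nrComplexPlaces, (nrRealPlaces_QSqrt hp).1,
      (nrRealPlaces_QSqrt hp).2]
  obtain ⟨w', hw'⟩ := Fintype.exists_ne_of_one_lt_card (by omega) w
  have hrank : Fintype.card {v : InfinitePlace (QSqrt p) // v ≠ w'} =
      Fintype.card (Fin (Units.rank (QSqrt p))) := by
    rw [Fintype.card_subtype_compl, Fintype.card_subtype_eq, hcard, Fintype.card_fin, rank_QSqrt hp]
  have hsub : Subsingleton {v : InfinitePlace (QSqrt p) // v ≠ w'} := by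
    rw [← Fintype.card_le_one_iff_subsingleton, hrank, Fintype.card_fin, rank_QSqrt hp]
  rw [Units.regulator_eq_det _ w' (Fintype.equivOfCardEq hrank),
    Matrix.det_eq_elem_of_subsingleton _ ⟨w, hw'.symm⟩]
  simp only [Matrix.of_apply, hmult, Nat.cast_one, one_mul, hw]
  exact log_fundamentalUnit_le hp (fundSystem_notMem_torsion _ _)

theorem two_mul_classNumber_mul_log_le {p : ℕ} (hp : p.Prime) (h4 : p % 4 = 1) :
    2 * (classNumber (QSqrt p) : ℝ) * Real.log (fundamentalUnit p) ≤
      √p * dedekindZeta_residue (QSqrt p) := by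
  have hw : (Units.torsionOrder (QSqrt p) : ℝ) ≤ 2 := by
    exact_mod_cast torsionOrder_QSqrt_le_two p
  have hw0 : (0 : ℝ) < Units.torsionOrder (QSqrt p) := by
    exact_mod_cast Units.torsionOrder_pos (QSqrt p)
  have hp0 : 0 < √(p : ℝ) := Real.sqrt_pos.2 (Nat.cast_pos.2 hp.pos)
  have hR := Units.regulator_pos (QSqrt p)
  rw [dedekindZeta_residue_def, (nrRealPlaces_QSqrt hp).1, (nrRealPlaces_QSqrt hp).2,
    discr_QSqrt hp h4, Int.cast_natCast, Nat.abs_cast, ← mul_div_assoc, le_div_iff₀ (by positivity)]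
  calc 2 * (classNumber (QSqrt p) : ℝ) * Real.log (fundamentalUnit p) *
        (Units.torsionOrder (QSqrt p) * √p)
      ≤ 2 * (classNumber (QSqrt p) : ℝ) * Units.regulator (QSqrt p) * (2 * √p) := by
        gcongr
        exact log_fundamentalUnit_le_regulator hp
    _ = _ := by ring

end ClassNumberFormula

section UpperBound

theorem beta_le_half_of_legendreBound_le {p : ℕ} [Fact p.Prime] (hp : p % 4 = 1) {M : ℕ}
    (hM : 1 ≤ M) {c : ℝ} (hc : legendreBound p M ≤ c)
    (h : Real.log p + √p * c ≤ (p - 1) * Real.log 2 / 2) : beta p ≤ 1 / 2 := by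
  have hprime : p.Prime := Fact.out
  have hp1 : (1 : ℝ) < p := by exact_mod_cast hprime.one_lt
  obtain ⟨θ, -, hθ⟩ := exists_sq_eq_self_add hp
  have hclass := two_mul_classNumber_mul_log_le hprime hp
  have hres := dedekindZeta_residue_le_legendreBound (finrank_QSqrt hprime) hp hθ hM
  have hmul := mul_le_mul_of_nonneg_left (hres.trans hc) (Real.sqrt_nonneg (p : ℝ))
  rw [beta, div_le_iff₀ (mul_pos (sub_pos.2 hp1) (Real.log_pos one_lt_two))]
  linarith

theorem log_le_eight_mul_log_two_add_sqrt {x : ℝ} (hx : 0 < x) :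
    Real.log x ≤ 8 * Real.log 2 + √x / 8 - 2 := by
  have hsqrt := Real.sqrt_pos.2 hx
  have hlog := Real.log_le_sub_one_of_pos (div_pos hsqrt (by norm_num : (0 : ℝ) < 2 ^ 4))
  rw [Real.log_div hsqrt.ne' (by norm_num), Real.log_pow, Real.log_sqrt hx.le] at hlog
  push_cast at hlog
  linarith

theorem beta_le_half_of_two_hundred_eighty_nine_le {p : ℕ} [Fact p.Prime] (hp : p % 4 = 1)
    (h : 289 ≤ p) : beta p ≤ 1 / 2 := by
  have hp0 : (0 : ℝ) < p := by exact_mod_cast (by omega : 0 < p)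
  have hlogp := log_le_eight_mul_log_two_add_sqrt hp0
  have hlog4 : Real.log (p / 4 : ℕ) ≤ Real.log p - 2 * Real.log 2 := by
    have hquot : (0 : ℝ) < (p / 4 : ℕ) := by exact_mod_cast (by omega : 0 < p / 4)
    rw [← Nat.cast_ofNat (n := 2), ← Real.log_pow, ← Real.log_div hp0.ne' (by norm_num)]
    refine Real.log_le_log hquot (Nat.cast_div_le.trans ?_)
    norm_num
  refine beta_le_half_of_legendreBound_le hp (by omega)
    ((legendreBound_le_one_add_log p).trans (add_le_add_right (hlog4.trans (by gcongr)) 1)) ?_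
  have hsq : √(p : ℝ) ^ 2 = p := Real.sq_sqrt hp0.le
  have h17 : (17 : ℝ) ≤ √p := Real.le_sqrt_of_sq_le (by norm_num; exact_mod_cast h)
  have hL := Real.log_two_gt_d9
  have hL' := Real.log_two_lt_d9
  nlinarith [mul_nonneg (sub_nonneg.2 h17) (sub_nonneg.2 h17)]

end UpperBound

section FiniteCheck

theorem legendreSym_eq_bmod {p : ℕ} [Fact p.Prime] (hp : p ≠ 2) (a : ℤ) :
    legendreSym p a = (a ^ (p / 2)).bmod p := by
  have hp3 : 2 < p := lt_of_le_of_ne (Fact.out : p.Prime).two_le hp.symm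
  have hdvd : (p : ℤ) ∣ legendreSym p a - a ^ (p / 2) := by
    rw [← ZMod.intCast_eq_intCast_iff_dvd_sub, legendreSym.eq_pow, Int.cast_pow]
  obtain ⟨hlower, hupper⟩ := abs_le.1 (abs_legendreSym_le_one p a)
  exact ((Int.bmod_eq_iff (by omega)).2 ⟨by omega, by omega, hdvd⟩).symm

/-- The rational number `legendreBound p p`, in a form that can be evaluated. -/
def legendreBoundRat (p : ℕ) : ℚ :=
  ∑ n ∈ Finset.range p, (((n : ℤ) ^ (p / 2)).bmod p : ℚ) * (n : ℚ)⁻¹ + (p / 4 : ℕ) * (p : ℚ)⁻¹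

theorem legendreBound_self_eq_cast {p : ℕ} [Fact p.Prime] (hp : p ≠ 2) :
    legendreBound p p = legendreBoundRat p := by
  rw [legendreBound_self hp, legendreBoundRat]
  push_cast
  simp only [legendreSym_eq_bmod hp]

theorem log_le_mul_log_two_add {x : ℝ} (hx : 0 < x) (k : ℕ) :
    Real.log x ≤ k * Real.log 2 + (x / 2 ^ k - 1) := by
  have h := Real.log_le_sub_one_of_pos (div_pos hx (pow_pos two_pos k))
  rw [Real.log_div hx.ne' (by positivity), Real.log_pow] at h
  linarith

theorem beta_le_half_of_legendreBoundRat {p : ℕ} [Fact p.Prime] (hp : p % 4 = 1) {k : ℕ} {r : ℚ}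
    (hk : 2 * k < p) (hr : 0 ≤ r) (hpr : p ≤ r ^ 2) (hc : 0 ≤ legendreBoundRat p)
    (h : p / 2 ^ k - 1 + r * legendreBoundRat p ≤ ((p - 1) / 2 - k) * 0.6931471803) :
    beta p ≤ 1 / 2 := by
  have hp0 : (0 : ℝ) < p := by exact_mod_cast (by omega : 0 < p)
  refine beta_le_half_of_legendreBound_le hp (by omega : 1 ≤ p)
    (legendreBound_self_eq_cast (by rintro rfl; omega)).le ?_
  have hsqrt : √(p : ℝ) ≤ r := Real.sqrt_le_left (by exact_mod_cast hr) |>.2 (by exact_mod_cast hpr)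
  have hcast : (p : ℝ) / 2 ^ k - 1 + r * legendreBoundRat p ≤
      ((p - 1) / 2 - k) * 0.6931471803 := by
    have := Rat.cast_le (K := ℝ).2 h
    push_cast at this
    exact this
  have hmul : √(p : ℝ) * legendreBoundRat p ≤ r * legendreBoundRat p :=
    mul_le_mul_of_nonneg_right hsqrt (by exact_mod_cast hc)
  have hlog2 : (((p : ℝ) - 1) / 2 - k) * 0.6931471803 ≤ ((p - 1) / 2 - k) * Real.log 2 := by
    have hk' : (2 : ℝ) * k + 1 ≤ p := by exact_mod_cast hk
    exact mul_le_mul_of_nonneg_left Real.log_two_gt_d9.le (by linarith)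
  linarith [log_le_mul_log_two_add hp0 k]

theorem beta_le_half_of_lt_two_hundred_eighty_nine {p : ℕ} [Fact p.Prime] (hp : p % 4 = 1)
    (h29 : 29 ≤ p) (h : p < 289) : beta p ≤ 1 / 2 := by
  have hcheck : ∀ p ∈ Finset.range 289, p.Prime → p % 4 = 1 → 29 ≤ p →
      let k := Nat.log 2 p
      let r : ℚ := (Nat.sqrt (10 ^ 4 * p) + 1 : ℕ) / 100
      2 * k < p ∧ 0 ≤ r ∧ p ≤ r ^ 2 ∧ 0 ≤ legendreBoundRat p ∧
        p / 2 ^ k - 1 + r * legendreBoundRat p ≤ ((p - 1) / 2 - k) * 0.6931471803 := by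
    decide +kernel
  obtain ⟨hk, hr, hpr, hc, hbound⟩ := hcheck p (Finset.mem_range.2 h) Fact.out hp h29
  exact beta_le_half_of_legendreBoundRat hp hk hr hpr hc hbound

end FiniteCheck

section LowerBound

theorem half_lt_beta {p : ℕ} (hp : p.Prime) {x : ℝ} (hx : 0 < x) (hε : x ≤ fundamentalUnit p)
    (h : (2 : ℝ) ^ (p - 1) < (p * x ^ 2) ^ 2) : 1 / 2 < beta p := by
  have hp1 : (1 : ℝ) < p := by exact_mod_cast hp.one_lt
  have hclass : (1 : ℝ) ≤ NumberField.classNumber (QSqrt p) := by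
    exact_mod_cast NumberField.classNumber_pos (QSqrt p)
  obtain ⟨u, hu, huε⟩ := exists_isFundamentalUnit_unitVal_eq hp
  have hlogε : 0 ≤ Real.log (fundamentalUnit p) := (Real.log_pos (huε ▸ hu.1)).le
  have hlogx : Real.log x ≤
      NumberField.classNumber (QSqrt p) * Real.log (fundamentalUnit p) :=
    (Real.log_le_log hx hε).trans (le_mul_of_one_le_left hlogε hclass)
  have hlog := Real.log_lt_log (by positivity) h
  rw [Real.log_pow, Real.log_pow, Real.log_mul (by linarith) (by positivity), Real.log_pow,
    Nat.cast_sub hp.one_lt.le] at hlog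
  push_cast at hlog
  rw [beta, lt_div_iff₀ (mul_pos (sub_pos.2 hp1) (Real.log_pos one_lt_two))]
  linarith

theorem half_lt_beta_of_sq_le {p : ℕ} (hp : p.Prime) (h4 : p % 4 = 1) {a b : ℕ}
    (ha : a ^ 2 + 4 < p) (hb : b ^ 2 ≤ p)
    (h : 2 ^ (p - 1) * 2 ^ 4 < (p * (a + 1 + b) ^ 2) ^ 2) : 1 / 2 < beta p := by
  obtain ⟨u, hu, huε⟩ := exists_isFundamentalUnit_unitVal_eq hp
  have hab := add_le_two_mul_unitVal hp h4 ha hb hu.1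
  refine half_lt_beta hp (x := (a + 1 + b) / 2) (by positivity) (by linarith) ?_
  have h' : (2 : ℝ) ^ (p - 1) * 2 ^ 4 < (p * (a + 1 + b) ^ 2) ^ 2 := by exact_mod_cast h
  linear_combination h' / 16

end LowerBound

theorem P21_inter_eq : P21 ∩ {5, 13, 17} = {17} := by
  ext p
  constructor
  · rintro ⟨⟨-, -, horder⟩, rfl | rfl | rfl⟩
    · exact absurd (horder ▸ pow_orderOf_eq_one (2 : ZMod 5)) (by decide)
    · exact absurd (horder ▸ pow_orderOf_eq_one (2 : ZMod 13)) (by decide)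
    · rfl
  · rintro rfl
    exact ⟨⟨by decide, rfl, orderOf_eq_prime_pow (p := 2) (n := 2) (by decide) (by decide)⟩,
      by simp⟩

end ThueMorse

theorem mainTheorem6_general :
    {p : ℕ | p.Prime ∧ p % 4 = 1 ∧ ThueMorse.beta p > 1 / 2} = {5, 13, 17} := by
  open ThueMorse in
  ext p
  constructor
  · rintro ⟨hp, h4, hβ⟩
    have : Fact p.Prime := ⟨hp⟩
    have h29 : p < 29 := by
      by_contra! h29
      rcases lt_or_ge p 289 with h | h
      · exact hβ.not_ge (beta_le_half_of_lt_two_hundred_eighty_nine h4 h29 h)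
      · exact hβ.not_ge (beta_le_half_of_two_hundred_eighty_nine_le h4 h)
    have : ∀ p < 29, p.Prime → p % 4 = 1 → p ∈ ({5, 13, 17} : Set ℕ) := by decide
    exact this p h29 hp h4
  · rintro (rfl | rfl | rfl)
    · exact ⟨by decide, rfl, half_lt_beta_of_sq_le (a := 0) (b := 2) (by decide) rfl (by norm_num)
        (by norm_num) (by norm_num)⟩
    · exact ⟨by decide, rfl, half_lt_beta_of_sq_le (a := 2) (b := 3) (by decide) rfl (by norm_num)
        (by norm_num) (by norm_num)⟩
    · exact ⟨by decide, rfl, half_lt_beta_of_sq_le (a := 3) (b := 4) (by decide) rfl (by norm_num)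
        (by norm_num) (by norm_num)⟩

theorem mainTheorem6 :
    {p : ℕ | p ∈ ThueMorse.P21 ∧ ThueMorse.beta p > 1 / 2}.Finite ∧
      {p : ℕ | p ∈ ThueMorse.P21 ∧ ThueMorse.beta p > 1 / 2} = {17} := by
  have h : {p : ℕ | p ∈ ThueMorse.P21 ∧ ThueMorse.beta p > 1 / 2} = {17} := by
    rw [← ThueMorse.P21_inter_eq, ← mainTheorem6_general]
    exact Set.ext fun p => and_congr_right fun hp =>
      ⟨fun hβ => ⟨hp.1, hp.2.1, hβ⟩, fun hβ => hβ.2.2⟩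
  exact ⟨h ▸ Set.finite_singleton 17, h⟩
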